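/- Let $G=(V,E)$ be a locally finite, vertex-transitive (simple, undirected) graph, that is, every vertex has finite degree and for all $x,y\in V$ some automorphism of $G$ maps $x$ to $y$; let $0\in V$ be a fixed vertex. For $p\in[0,1]$ let $\mathbb{P}_p$, with expectation $\mathbb{E}_p$, be Bernoulli bond percolation on $G$: every edge is open with probability $p$ and closed with probability $1-p$, independently of the other edges. Let $\mathcal{C}(0)$ be the set of vertices joined to $0$ by a path of open edges, and let $$p_c=\sup\{p\in[0,1]:\mathbb{P}_p(|\mathcal{C}(0)|=\infty)=0\}$$ be the critical probability. Let $d_{\mathrm{chem}}(x,y)$ be the length of the shortest open path between $x$ and $y$ ($\infty$ if there is none), and for an integer $r\ge 0$ let $$B_{\mathrm{chem}}(r)=\{x\in V:d_{\mathrm{chem}}(0,x)\le r\},\qquad G(r)=\mathbb{E}_{p_c}|B_{\mathrm{chem}}(r)|.$$ Then $G(r)=e^{o(r)}$ as $r\to\infty$: there is a function $f:\mathbb{N}\to\mathbb{R}$ with $f(r)/r\to 0$ as $r\to\infty$ such that $G(r)=e^{f(r)}$ (in particular $G(r)<\infty$) for every integer $r\ge 0$. -/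

import Mathlib

open MeasureTheory Filter Asymptotics
open scoped ENNReal unitInterval

namespace Percolation

/-- A graph is vertex-transitive if its automorphisms act transitively on the vertices. -/
def IsVertexTransitive {V : Type*} (G : SimpleGraph V) : Prop :=
  ∀ x y : V, ∃ φ : G ≃g G, φ x = y

/-- A percolation configuration: an edge `e` of `G` is open if `ω e = true`, closed otherwise. -/
abbrev Config {V : Type*} (G : SimpleGraph V) : Type _ := G.edgeSet → Bool

/-- The law `ℙ_p` of Bernoulli bond percolation on `G`: the edges are open with probability `p`,
independently of each other. -/
noncomputable def bondMeasure {V : Type*} (G : SimpleGraph V) (p : I) : Measure (Config G) :=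
  Measure.infinitePi fun _ : G.edgeSet => ProbabilityTheory.bernoulliMeasure true false p

/-- The subgraph (on all vertices) formed by the open edges of the configuration `ω`. -/
def openGraph {V : Type*} (G : SimpleGraph V) (ω : Config G) : SimpleGraph V where
  Adj x y := ∃ h : s(x, y) ∈ G.edgeSet, ω ⟨s(x, y), h⟩ = true
  symm := ⟨fun x y h => by rwa [Sym2.eq_swap]⟩
  loopless := ⟨fun _ h => G.irrefl h.1⟩

/-- The cluster `𝒞(x)`: the vertices connected to `x` by a path of open edges. -/
def cluster {V : Type*} (G : SimpleGraph V) (ω : Config G) (x : V) : Set V :=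
  {y | (openGraph G ω).Reachable x y}

/-- The critical probability `p_c`, the supremum of the `p ∈ [0, 1]` for which the cluster of `o` is
finite almost surely. -/
noncomputable def criticalProb {V : Type*} (G : SimpleGraph V) (o : V) : I :=
  sSup {p : I | bondMeasure G p {ω | (cluster G ω o).Infinite} = 0}

/-- The intrinsic distance `d_chem(x, y)`: the length of the shortest open path from `x` to `y`,
and `⊤` if there is none. -/
noncomputable def chemDist {V : Type*} (G : SimpleGraph V) (ω : Config G) (x y : V) : ℕ∞ :=
  (openGraph G ω).edist x y

/-- The intrinsic ball `B_chem(x, r)`. -/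
def chemBall {V : Type*} (G : SimpleGraph V) (ω : Config G) (x : V) (r : ℕ) : Set V :=
  {y | chemDist G ω x y ≤ r}

/-- The expected size `𝔼_p |B_chem(o, r)|` of the intrinsic ball, as an element of `[0, ∞]`. -/
noncomputable def expectedChemBall {V : Type*} (G : SimpleGraph V) (p : I) (o : V) (r : ℕ) :
    ℝ≥0∞ :=
  ∫⁻ ω, ((chemBall G ω o r).encard : ℝ≥0∞) ∂(bondMeasure G p)

end Percolation

/-! For a finite set `S` containing `o`, let φ_p(S) be the expected number of open edges leaving `S`
from a vertex connected to `o` inside `S` (`expectedExits`, the quantity of Duminil-Copin and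
Tassion).

If φ_p(S) < 1 for some `S`, an open path from `o` that ends outside `S` must make a last exit from
the cluster of `o` in `S`, and what follows is independent of that cluster. With transitivity, the
largest expected ball size M satisfies M ≤ |S| + φ_p(S) M, so expected balls are bounded uniformly
in the radius (`expect_card_edgeBall_le_div`).

If φ_p(S) ≥ 1 for all `S` and all p in an interval [p₀, p₁] with p₀ < p₁, Russo's formula shows that
the probability u(p) that `o` cannot leave a finite region satisfies u' ≤ -u there. Hence u(p₁) ≤
exp(-(p₁ - p₀)) < 1 uniformly in the region, and the cluster is infinite with positive probability
at p₁ (`expect_trapped_le_exp`, `bondMeasure_infinite_ne_zero`).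

So for every ε > 0 some p in [e^{-ε} p_c, p_c] admits an `S` with φ_p(S) < 1. Thinning
p_c-percolation to level p with retention probability q ≥ e^{-ε} keeps a given open path of length
at most r with probability at least q^r, so q^r G(r) is at most the expected ball size at p
(`pow_mul_expect_card_edgeBall_le`). Hence G(r) ≤ C e^{εr}.

All of this is done with finite sums over subsets of a finite edge set; the product measure enters
only through cylinder events. -/

namespace Percolation

/-! ### Bernoulli subsets of a finite set: independence, Russo's formula, thinning. -/

section FiniteExpectation

variable {α β : Type*} [DecidableEq α] [DecidableEq β]

/-- The expectation of `F T`, where the random set `T ⊆ E` contains each element of `E`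
independently with probability `p`. -/
noncomputable def expect (E : Finset α) (p : ℝ) (F : Finset α → ℝ) : ℝ :=
  ∑ T ∈ E.powerset, p ^ T.card * (1 - p) ^ (E \ T).card * F T

@[simp] lemma expect_empty (p : ℝ) (F : Finset α → ℝ) : expect ∅ p F = F ∅ := by
  simp [expect]

lemma expect_insert {E : Finset α} {e : α} (he : e ∉ E) (p : ℝ) (F : Finset α → ℝ) :
    expect (insert e E) p F =
      p * expect E p (fun T => F (insert e T)) + (1 - p) * expect E p F := by
  rw [expect, Finset.sum_powerset_insert he, expect, expect, Finset.mul_sum, Finset.mul_sum,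
    add_comm]
  congr 1
  · refine Finset.sum_congr rfl fun T hT => ?_
    have hT' : e ∉ T := fun h => he (Finset.mem_powerset.1 hT h)
    rw [Finset.card_insert_of_notMem hT', Finset.insert_sdiff_insert,
      Finset.sdiff_insert_of_notMem he]
    ring
  · refine Finset.sum_congr rfl fun T hT => ?_
    have hT' : e ∉ T := fun h => he (Finset.mem_powerset.1 hT h)
    rw [Finset.insert_sdiff_of_notMem _ hT', Finset.card_insert_of_notMem (by simp [he])]
    ring

lemma expect_congr {E : Finset α} {p : ℝ} {F F' : Finset α → ℝ} (h : ∀ T ⊆ E, F T = F' T) :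
    expect E p F = expect E p F' :=
  Finset.sum_congr rfl fun T hT => by rw [h T (Finset.mem_powerset.1 hT)]

lemma expect_mono {E : Finset α} {p : ℝ} (hp : p ∈ Set.Icc 0 1) {F F' : Finset α → ℝ}
    (h : ∀ T ⊆ E, F T ≤ F' T) : expect E p F ≤ expect E p F' := by
  refine Finset.sum_le_sum fun T hT => mul_le_mul_of_nonneg_left (h T (Finset.mem_powerset.1 hT)) ?_
  have := hp.1
  have := sub_nonneg.2 hp.2
  positivity

lemma expect_const (E : Finset α) (p c : ℝ) : expect E p (fun _ => c) = c := by
  induction E using Finset.induction_on with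
  | empty => simp
  | insert e E he ih => rw [expect_insert he, ih]; ring

lemma expect_nonneg {E : Finset α} {p : ℝ} (hp : p ∈ Set.Icc 0 1) {F : Finset α → ℝ}
    (h : ∀ T ⊆ E, 0 ≤ F T) : 0 ≤ expect E p F := by
  simpa [expect_const] using expect_mono hp (F := fun _ => 0) h

lemma expect_add (E : Finset α) (p : ℝ) (F F' : Finset α → ℝ) :
    expect E p (fun T => F T + F' T) = expect E p F + expect E p F' := by
  simp only [expect, mul_add, Finset.sum_add_distrib]

lemma expect_sub (E : Finset α) (p : ℝ) (F F' : Finset α → ℝ) :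
    expect E p (fun T => F T - F' T) = expect E p F - expect E p F' := by
  simp only [expect, mul_sub, Finset.sum_sub_distrib]

lemma expect_const_mul (E : Finset α) (p c : ℝ) (F : Finset α → ℝ) :
    expect E p (fun T => c * F T) = c * expect E p F := by
  simp only [expect, Finset.mul_sum]
  exact Finset.sum_congr rfl fun T _ => by ring

lemma expect_sum {ι : Type*} (s : Finset ι) (E : Finset α) (p : ℝ) (F : ι → Finset α → ℝ) :
    expect E p (fun T => ∑ i ∈ s, F i T) = ∑ i ∈ s, expect E p (F i) := by
  simp only [expect, Finset.mul_sum]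
  exact Finset.sum_comm

lemma expect_union {A B : Finset α} (h : Disjoint A B) (p : ℝ) (F : Finset α → ℝ) :
    expect (A ∪ B) p F = expect A p fun T => expect B p fun U => F (T ∪ U) := by
  induction A using Finset.induction_on generalizing F with
  | empty => simp
  | insert e A he ih =>
    rw [Finset.disjoint_insert_left] at h
    rw [Finset.insert_union, expect_insert (by simp [he, h.1]), expect_insert he, ih h.2, ih h.2]
    simp only [Finset.insert_union]

/-- Independence of functions of disjoint sets of coordinates. -/
lemma expect_mul {E A : Finset α} {p : ℝ} {F F' : Finset α → ℝ}
    (hF : ∀ T ⊆ E, F T = F (T ∩ A)) (hF' : ∀ T ⊆ E, F' T = F' (T \ A)) :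
    expect E p (fun T => F T * F' T) = expect E p F * expect E p F' := by
  have hd : Disjoint (E ∩ A) (E \ A) := (Finset.disjoint_sdiff_inter E A).symm
  have hE : E = (E ∩ A) ∪ (E \ A) := by rw [Finset.union_comm, Finset.sdiff_union_inter]
  have key : ∀ T ⊆ E ∩ A, ∀ U ⊆ E \ A, F (T ∪ U) = F T ∧ F' (T ∪ U) = F' U := by
    intro T hT U hU
    have hTU : T ∪ U ⊆ E := Finset.union_subset (hT.trans Finset.inter_subset_left)
      (hU.trans Finset.sdiff_subset)
    rw [hF _ hTU, hF' _ hTU]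
    constructor
    · congr 1
      ext x
      have := @hT x
      have := @hU x
      simp only [Finset.mem_inter, Finset.mem_sdiff, Finset.mem_union] at *
      tauto
    · congr 1
      ext x
      have := @hT x
      have := @hU x
      simp only [Finset.mem_inter, Finset.mem_sdiff, Finset.mem_union] at *
      tauto
  have h1 : expect E p F = expect (E ∩ A) p F := by
    conv_lhs => rw [hE, expect_union hd]
    refine expect_congr fun T hT => ?_
    rw [expect_congr (F' := fun _ => F T) fun U hU => (key T hT U hU).1, expect_const]
  have h2 : expect E p F' = expect (E \ A) p F' := by
    conv_lhs => rw [hE, expect_union hd]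
    rw [expect_congr (F' := fun _ => expect (E \ A) p F') fun T hT =>
      expect_congr fun U hU => (key T hT U hU).2, expect_const]
  rw [h1, h2]
  conv_lhs => rw [hE, expect_union hd]
  rw [mul_comm, ← expect_const_mul]
  refine expect_congr fun T hT => ?_
  rw [mul_comm, ← expect_const_mul]
  exact expect_congr fun U hU => by rw [(key T hT U hU).1, (key T hT U hU).2]

lemma expect_of_inter {E A : Finset α} (hA : A ⊆ E) {p : ℝ} {F : Finset α → ℝ}
    (hF : ∀ T ⊆ E, F T = F (T ∩ A)) : expect E p F = expect A p F := by
  conv_lhs => rw [← Finset.union_sdiff_of_subset hA, expect_union Finset.disjoint_sdiff]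
  refine expect_congr fun T hT => ?_
  rw [expect_congr (F' := fun _ => F T), expect_const]
  intro U hU
  rw [hF _ (Finset.union_subset (hT.trans hA) (hU.trans Finset.sdiff_subset))]
  congr 1
  ext x
  have := @hT x
  have := @hU x
  simp only [Finset.mem_inter, Finset.mem_sdiff, Finset.mem_union] at *
  tauto

lemma expect_eq_indicator {E : Finset α} {p : ℝ} {e : α} (he : e ∈ E) :
    expect E p (fun T => if e ∈ T then 1 else 0) = p := by
  rw [expect_of_inter (Finset.singleton_subset_iff.2 he) (by simp),
    ← Finset.insert_empty, expect_insert (Finset.notMem_empty e)]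
  simp

/-- Russo's formula. -/
lemma hasDerivAt_expect (E : Finset α) (F : Finset α → ℝ) (p : ℝ) :
    HasDerivAt (fun q => expect E q F)
      (∑ e ∈ E, expect E p fun T => F (insert e T) - F (T.erase e)) p := by
  induction E using Finset.induction_on generalizing F with
  | empty => simpa using hasDerivAt_const p (F ∅)
  | insert e E he ih =>
    simp only [expect_insert he]
    have h := ((hasDerivAt_id p).mul (ih fun T => F (insert e T))).add
      (((hasDerivAt_id p).const_sub 1).mul (ih F))
    refine h.congr_deriv ?_
    rw [Finset.sum_insert he, Finset.sum_add_distrib, ← Finset.mul_sum, ← Finset.mul_sum]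
    have h1 : expect E p (fun T => F (insert e (insert e T)) - F ((insert e T).erase e)) =
        expect E p (fun T => F (insert e T)) - expect E p F := by
      rw [← expect_sub]
      refine expect_congr fun T hT => ?_
      rw [Finset.insert_idem, Finset.erase_insert fun h => he (hT h)]
    have h2 : expect E p (fun T => F (insert e T) - F (T.erase e)) =
        expect E p (fun T => F (insert e T)) - expect E p F := by
      rw [← expect_sub]
      refine expect_congr fun T hT => ?_
      rw [Finset.erase_eq_of_notMem fun h => he (hT h)]
    have h3 : ∀ f ∈ E, expect E p (fun T => F (insert f (insert e T)) - F ((insert e T).erase f)) =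
        expect E p (fun T => F (insert e (insert f T)) - F (insert e (T.erase f))) := by
      intro f hf
      have hne : e ≠ f := fun h => he (h ▸ hf)
      refine expect_congr fun T _ => ?_
      rw [Finset.insert_comm, Finset.erase_insert_of_ne hne]
    rw [Finset.sum_congr rfl h3, h1, h2]
    simp only [id]
    ring

/-- Thinning: keeping each element of a `p`-random set with probability `q` gives a
`p * q`-random set. -/
lemma expect_thinning (E : Finset α) (p q : ℝ) (F : Finset α → ℝ) :
    expect E p (fun T => expect T q F) = expect E (p * q) F := by
  induction E using Finset.induction_on generalizing F with
  | empty => simp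
  | insert e E he ih =>
    rw [expect_insert he, expect_insert he]
    have h : expect E p (fun T => expect (insert e T) q F) =
        q * expect E (p * q) (fun T => F (insert e T)) + (1 - q) * expect E (p * q) F := by
      rw [← ih, ← ih, ← expect_const_mul, ← expect_const_mul, ← expect_add]
      exact expect_congr fun T hT => expect_insert (fun h => he (hT h)) q F
    rw [h, ih]
    ring

lemma pow_le_expect_superset {E P : Finset α} (hP : P ⊆ E) {p : ℝ} {F : Finset α → ℝ}
    (hp : p ∈ Set.Icc 0 1) (hF : ∀ T ⊆ E, P ⊆ T → 1 ≤ F T) (hF0 : ∀ T ⊆ E, 0 ≤ F T) :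
    p ^ P.card ≤ expect E p F := by
  have h : expect E p (fun T => if P ⊆ T then 1 else 0) = p ^ P.card := by
    rw [expect_of_inter hP]
    · rw [expect, Finset.sum_eq_single P]
      · simp
      · intro T hT hTP
        rw [if_neg fun h => hTP ((Finset.mem_powerset.1 hT).antisymm h), mul_zero]
      · simp
    · intro T _
      simp [Finset.subset_inter_iff]
  rw [← h]
  refine expect_mono hp fun T hT => ?_
  split_ifs with h
  · exact hF T hT h
  · exact hF0 T hT

lemma expect_image {f : α → β} (hf : Function.Injective f) (E : Finset α) (p : ℝ)
    (F : Finset β → ℝ) : expect (E.image f) p F = expect E p fun T => F (T.image f) := by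
  induction E using Finset.induction_on generalizing F with
  | empty => simp
  | insert e E he ih =>
    have he' : f e ∉ E.image f := by simpa [hf.eq_iff] using he
    rw [Finset.image_insert, expect_insert he', expect_insert he, ih, ih]
    simp only [Finset.image_insert]

end FiniteExpectation

/-! ### Balls and clusters in finite edge configurations. -/

section FiniteGraph

open scoped Classical

variable {V : Type*}

/-- The graph whose edges are the elements of the finite set `T`. -/
abbrev edgeGraph (T : Finset (Sym2 V)) : SimpleGraph V := SimpleGraph.fromEdgeSet (T : Set (Sym2 V))

lemma edgeGraph_mono {T U : Finset (Sym2 V)} (h : T ⊆ U) : edgeGraph T ≤ edgeGraph U :=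
  SimpleGraph.fromEdgeSet_mono (Finset.coe_subset.2 h)

lemma edgeGraph_adj {T : Finset (Sym2 V)} {x y : V} :
    (edgeGraph T).Adj x y ↔ s(x, y) ∈ T ∧ x ≠ y := by
  simp [edgeGraph]

lemma finite_setOf_walk_edgeGraph (T : Finset (Sym2 V)) (z : V) (r : ℕ) :
    {y | ∃ w : (edgeGraph T).Walk z y, w.length ≤ r}.Finite := by
  refine (({z} ∪ T.biUnion Sym2.toFinset : Finset V).finite_toSet).subset ?_
  rintro y ⟨w, -⟩
  cases h : w.reverse with
  | nil => simp
  | cons hadj w' =>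
    simp only [Finset.coe_union, Set.mem_union, Finset.mem_coe, Finset.mem_biUnion]
    exact Or.inr ⟨_, (edgeGraph_adj.1 hadj).1, by simp⟩

/-- The ball of radius `r` about `z` in the graph with edge set `T`. -/
noncomputable def edgeBall (T : Finset (Sym2 V)) (z : V) (r : ℕ) : Finset V :=
  (finite_setOf_walk_edgeGraph T z r).toFinset

lemma mem_edgeBall {T : Finset (Sym2 V)} {z y : V} {r : ℕ} :
    y ∈ edgeBall T z r ↔ ∃ w : (edgeGraph T).Walk z y, w.length ≤ r := by
  simp [edgeBall]

lemma edgeBall_mono {T U : Finset (Sym2 V)} (h : T ⊆ U) (z : V) {r s : ℕ} (hrs : r ≤ s) :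
    edgeBall T z r ⊆ edgeBall U z s := by
  intro y hy
  obtain ⟨w, hw⟩ := mem_edgeBall.1 hy
  exact mem_edgeBall.2 ⟨w.mapLe (edgeGraph_mono h), by simpa using hw.trans hrs⟩

lemma edgeBall_cons {T : Finset (Sym2 V)} {a b y : V} {r : ℕ} (hab : s(a, b) ∈ T) (hne : a ≠ b)
    (hy : y ∈ edgeBall T b r) : y ∈ edgeBall T a (r + 1) := by
  obtain ⟨w, hw⟩ := mem_edgeBall.1 hy
  exact mem_edgeBall.2 ⟨.cons (edgeGraph_adj.2 ⟨hab, hne⟩) w, by simpa using hw⟩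

/-- The vertices of `S` connected to `o` by a path of edges in `T` inside `S`. -/
noncomputable def clusterIn (S : Finset V) (o : V) (T : Finset (Sym2 V)) : Finset V :=
  S.filter fun x => (edgeGraph (T ∩ S.sym2)).Reachable o x

lemma mem_clusterIn {S : Finset V} {o x : V} {T : Finset (Sym2 V)} :
    x ∈ clusterIn S o T ↔ x ∈ S ∧ (edgeGraph (T ∩ S.sym2)).Reachable o x := by
  simp [clusterIn]

lemma clusterIn_subset (S : Finset V) (o : V) (T : Finset (Sym2 V)) : clusterIn S o T ⊆ S :=
  Finset.filter_subset _ _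

lemma clusterIn_inter_sym2 (S : Finset V) (o : V) (T : Finset (Sym2 V)) :
    clusterIn S o (T ∩ S.sym2) = clusterIn S o T := by
  simp [clusterIn, Finset.inter_assoc]

lemma clusterIn_mono (S : Finset V) (o : V) {T U : Finset (Sym2 V)} (h : T ⊆ U) :
    clusterIn S o T ⊆ clusterIn S o U := by
  intro x hx
  rw [mem_clusterIn] at *
  exact ⟨hx.1, hx.2.mono (edgeGraph_mono (Finset.inter_subset_inter_right h))⟩

lemma self_mem_clusterIn {S : Finset V} {o : V} (ho : o ∈ S) (T : Finset (Sym2 V)) :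
    o ∈ clusterIn S o T :=
  mem_clusterIn.2 ⟨ho, .rfl⟩

lemma clusterIn_closed {S : Finset V} {o x y : V} {T : Finset (Sym2 V)} (hx : x ∈ clusterIn S o T)
    (hy : y ∈ S) (hxy : s(x, y) ∈ T) (hne : x ≠ y) : y ∈ clusterIn S o T := by
  rw [mem_clusterIn] at *
  refine ⟨hy, hx.2.trans (SimpleGraph.Adj.reachable (edgeGraph_adj.2 ⟨?_, hne⟩))⟩
  simp [hxy, hx.1, hy]

lemma mem_of_reachable_of_closed {H : SimpleGraph V} {C : Set V} {a b : V}
    (hC : ∀ x y, x ∈ C → H.Adj x y → y ∈ C) (ha : a ∈ C) (h : H.Reachable a b) : b ∈ C := by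
  obtain ⟨w⟩ := h
  induction w with
  | nil => exact ha
  | cons hadj _ ih => exact ih (hC _ _ ha hadj)

/-- The edges of `T` with no endpoint in `C`. -/
noncomputable def edgesAvoiding (C : Finset V) (T : Finset (Sym2 V)) : Finset (Sym2 V) :=
  T.filter fun e => ∀ v ∈ e, v ∉ C

lemma mem_edgesAvoiding {C : Finset V} {T : Finset (Sym2 V)} {e : Sym2 V} :
    e ∈ edgesAvoiding C T ↔ e ∈ T ∧ ∀ v ∈ e, v ∉ C := by
  simp [edgesAvoiding]

/-- Exploring the cluster of `o` until it is found to be `C` only inspects edges with an endpoint in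
`C`. Hence this event is independent of everything built from edges avoiding `C`. -/
lemma clusterIn_eq_iff_sdiff_edgesAvoiding {S C : Finset V} {o : V} (ho : o ∈ S)
    {T E : Finset (Sym2 V)} (hT : T ⊆ E) :
    clusterIn S o T = C ↔ clusterIn S o (T ∩ (E \ edgesAvoiding C E)) = C := by
  have hsub := clusterIn_mono S o (Finset.inter_subset_left : T ∩ (E \ edgesAvoiding C E) ⊆ T)
  have hstep : ∀ x y, x ∈ C → (edgeGraph (T ∩ S.sym2)).Adj x y →
      y ∈ S ∧ s(x, y) ∈ T ∩ (E \ edgesAvoiding C E) ∧ x ≠ y := by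
    intro x y hx hxy
    obtain ⟨h1, h2⟩ := edgeGraph_adj.1 hxy
    simp only [Finset.mem_inter, Finset.mk_mem_sym2_iff] at h1
    refine ⟨h1.2.2, ?_, h2⟩
    simp only [Finset.mem_inter, Finset.mem_sdiff, mem_edgesAvoiding, h1.1, hT h1.1, true_and]
    intro h
    exact h x (by simp) hx
  constructor
  · intro h
    refine (h ▸ hsub).antisymm ?_
    intro x hx
    rw [← h] at hx
    refine (mem_of_reachable_of_closed (H := edgeGraph (T ∩ S.sym2))
      (C := (clusterIn S o (T ∩ (E \ edgesAvoiding C E)) : Set V)) ?_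
      (self_mem_clusterIn ho _) (mem_clusterIn.1 hx).2 :)
    intro a b ha hab
    obtain ⟨h1, h2, h3⟩ := hstep a b (h ▸ hsub ha) hab
    exact clusterIn_closed ha h1 h2 h3
  · intro h
    refine Finset.Subset.antisymm ?_ (h ▸ hsub)
    intro x hx
    refine (mem_of_reachable_of_closed (H := edgeGraph (T ∩ S.sym2)) (C := (C : Set V)) ?_
      (Finset.mem_coe.2 (h ▸ self_mem_clusterIn ho _)) (mem_clusterIn.1 hx).2 :)
    intro a b ha hab
    obtain ⟨h1, h2, h3⟩ := hstep a b ha hab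
    have ha' : a ∈ clusterIn S o (T ∩ (E \ edgesAvoiding C E)) := by rw [h]; exact ha
    have := clusterIn_closed ha' h1 h2 h3
    rwa [h] at this

/-- Cut the walk after its last visit to `C`: `x` is the last vertex in `C`, `z` the next one, and
the rest uses only edges avoiding `C`. The first alternative is a walk that never meets `C`. -/
lemma exists_last_exit {T : Finset (Sym2 V)} {C : Finset V} {a y : V} (w : (edgeGraph T).Walk a y)
    (hy : y ∉ C) :
    (a ∉ C ∧ y ∈ edgeBall (edgesAvoiding C T) a w.length) ∨
      ∃ x ∈ C, ∃ z ∉ C, s(x, z) ∈ T ∧ y ∈ edgeBall (edgesAvoiding C T) z w.length := by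
  induction w with
  | nil => exact Or.inl ⟨hy, mem_edgeBall.2 ⟨.nil, by simp⟩⟩
  | @cons a b y hadj w ih =>
    rw [edgeGraph_adj] at hadj
    obtain ⟨hb, hw⟩ | ⟨x, hx, z, hz, hxz, hw⟩ := ih hy
    · by_cases ha : a ∈ C
      · exact Or.inr ⟨a, ha, b, hb, hadj.1, edgeBall_mono subset_rfl _ (by simp) hw⟩
      · refine Or.inl ⟨ha, edgeBall_cons (mem_edgesAvoiding.2 ⟨hadj.1, ?_⟩) hadj.2 hw⟩
        simp [ha, hb]
    · exact Or.inr ⟨x, hx, z, hz, hxz, edgeBall_mono subset_rfl _ (by simp) hw⟩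

variable (G : SimpleGraph V)

/-- The edges of `G` with both endpoints in `S`. -/
noncomputable def edgesInside (S : Finset V) : Finset (Sym2 V) :=
  S.sym2.filter fun e => e ∈ G.edgeSet

variable {G} in
lemma inter_edgesInside {T : Finset (Sym2 V)} (hT : (T : Set (Sym2 V)) ⊆ G.edgeSet)
    (S : Finset V) : T ∩ edgesInside G S = T ∩ S.sym2 := by
  ext e
  simp only [edgesInside, Finset.mem_inter, Finset.mem_filter]
  exact ⟨fun h => ⟨h.1, h.2.1⟩, fun h => ⟨h.1, h.2, hT h.1⟩⟩

/-- The probability that `x` is connected to `o` by an open path inside `S`. -/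
noncomputable def connProbIn (p : ℝ) (S : Finset V) (o x : V) : ℝ :=
  expect (edgesInside G S) p fun T => if x ∈ clusterIn S o T then 1 else 0

variable {G}

lemma connProbIn_nonneg {p : ℝ} (hp : p ∈ Set.Icc 0 1) (S : Finset V) (o x : V) :
    0 ≤ connProbIn G p S o x :=
  expect_nonneg hp fun T _ => by positivity

lemma expect_mem_clusterIn {E : Finset (Sym2 V)} (hE : (E : Set (Sym2 V)) ⊆ G.edgeSet)
    {S : Finset V} (hS : edgesInside G S ⊆ E) (p : ℝ) (o x : V) :
    expect E p (fun T => if x ∈ clusterIn S o T then 1 else 0) = connProbIn G p S o x := by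
  rw [connProbIn, expect_of_inter hS]
  intro T hT
  rw [inter_edgesInside ((Finset.coe_subset.2 hT).trans hE), clusterIn_inter_sym2]

variable (G) [G.LocallyFinite]

/-- The expected number of open edges on the boundary of `S` whose inner endpoint is connected
to `o` inside `S`. -/
noncomputable def expectedExits (p : ℝ) (S : Finset V) (o : V) : ℝ :=
  ∑ x ∈ S, ∑ _y ∈ G.neighborFinset x \ S, p * connProbIn G p S o x

variable {G}

end FiniteGraph

/-! ### Few expected exits from a finite set: bounded expected balls. -/

section Subcritical

open scoped Classical

variable {V : Type*} {G : SimpleGraph V} [G.LocallyFinite]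

/-- Apply the last exit decomposition to the cluster of `o` in `S`. The exit vertex `z` is outside
`S`, since otherwise it would belong to that cluster. The radius is not decreased, as the bound
sought is uniform in it. -/
lemma card_edgeBall_le {T : Finset (Sym2 V)} (hT : (T : Set (Sym2 V)) ⊆ G.edgeSet) {S : Finset V}
    {o : V} (ho : o ∈ S) (r : ℕ) :
    ((edgeBall T o r).card : ℝ) ≤ S.card + ∑ x ∈ S, ∑ z ∈ G.neighborFinset x \ S,
      (if x ∈ clusterIn S o T ∧ s(x, z) ∈ T then
        ((edgeBall (edgesAvoiding (clusterIn S o T) T) z r).card : ℝ) else 0) := by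
  have hsub : edgeBall T o r ⊆ S ∪ S.biUnion fun x => (G.neighborFinset x \ S).biUnion fun z =>
      if x ∈ clusterIn S o T ∧ s(x, z) ∈ T then
        edgeBall (edgesAvoiding (clusterIn S o T) T) z r else ∅ := by
    intro y hy
    by_cases hyS : y ∈ S
    · exact Finset.mem_union_left _ hyS
    refine Finset.mem_union_right _ ?_
    obtain ⟨w, hw⟩ := mem_edgeBall.1 hy
    obtain ⟨h, -⟩ | ⟨x, hx, z, hz, hxz, h⟩ :=
      exists_last_exit w (fun h => hyS (clusterIn_subset S o T h))
    · exact absurd (self_mem_clusterIn ho T) h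
    · have hadj : G.Adj x z := hT hxz
      have hzS : z ∉ S := fun hzS => hz (clusterIn_closed hx hzS hxz hadj.ne)
      simp only [Finset.mem_biUnion]
      refine ⟨x, clusterIn_subset S o T hx, z, by simp [hadj, hzS], ?_⟩
      rw [if_pos ⟨hx, hxz⟩]
      exact edgeBall_mono subset_rfl z hw h
  have h : (edgeBall T o r).card ≤ S.card + ∑ x ∈ S, ∑ z ∈ G.neighborFinset x \ S,
      (if x ∈ clusterIn S o T ∧ s(x, z) ∈ T then
        (edgeBall (edgesAvoiding (clusterIn S o T) T) z r).card else 0) := by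
    refine (Finset.card_le_card hsub).trans ((Finset.card_union_le _ _).trans ?_)
    refine Nat.add_le_add_left (Finset.card_biUnion_le.trans ?_) _
    refine Finset.sum_le_sum fun x _ => Finset.card_biUnion_le.trans (Finset.sum_le_sum fun z _ => ?_)
    split_ifs <;> simp
  exact_mod_cast h

-- Sum over the possible values `C` of the cluster. The event that it equals `C`, the state of the
-- edge `s(x, z)`, and the ball about `z` avoiding `C` depend on disjoint sets of edges, so the
-- expectation factorizes.
omit [G.LocallyFinite] in
lemma expect_exit_le {E : Finset (Sym2 V)} (hE : (E : Set (Sym2 V)) ⊆ G.edgeSet) {S : Finset V}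
    (hS : edgesInside G S ⊆ E) {o : V} (ho : o ∈ S) {p : ℝ} (hp : p ∈ Set.Icc 0 1) {r : ℕ} {M : ℝ}
    (hM : ∀ z, expect E p (fun T => ((edgeBall T z r).card : ℝ)) ≤ M) {x z : V}
    (hz : z ∉ S) :
    expect E p (fun T => if x ∈ clusterIn S o T ∧ s(x, z) ∈ T then
        ((edgeBall (edgesAvoiding (clusterIn S o T) T) z r).card : ℝ) else 0) ≤
      p * connProbIn G p S o x * M := by
  have hM0 : 0 ≤ M := (expect_nonneg hp fun T _ => by positivity).trans (hM o)
  by_cases hxz : s(x, z) ∈ E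
  swap
  · rw [expect_congr (F' := fun _ => 0), expect_const]
    · exact mul_nonneg (mul_nonneg hp.1 (connProbIn_nonneg hp _ _ _)) hM0
    · exact fun T hT => if_neg fun h => hxz (hT h.2)
  have hdec : ∀ T ⊆ E, (if x ∈ clusterIn S o T ∧ s(x, z) ∈ T then
        ((edgeBall (edgesAvoiding (clusterIn S o T) T) z r).card : ℝ) else 0) =
      ∑ C ∈ S.powerset.filter (x ∈ ·),
        ((if clusterIn S o T = C then 1 else 0) * (if s(x, z) ∈ T then 1 else 0)) *
          ((edgeBall (edgesAvoiding C T) z r).card : ℝ) := by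
    intro T _
    by_cases hx : x ∈ clusterIn S o T
    · rw [Finset.sum_eq_single_of_mem (clusterIn S o T) (by simp [hx, clusterIn_subset])]
      · simp [hx]
      · intro C _ hC
        simp [hC.symm]
    · rw [if_neg (fun h => hx h.1), Finset.sum_eq_zero]
      intro C hC
      have : clusterIn S o T ≠ C := fun h => hx (h ▸ (Finset.mem_filter.1 hC).2)
      simp [this]
  have hC : ∀ C ∈ S.powerset.filter (x ∈ ·),
      expect E p (fun T => ((if clusterIn S o T = C then 1 else 0) *
        (if s(x, z) ∈ T then 1 else 0)) * ((edgeBall (edgesAvoiding C T) z r).card : ℝ)) ≤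
      p * expect E p (fun T => if clusterIn S o T = C then 1 else 0) * M := by
    intro C hC
    have hxC := (Finset.mem_filter.1 hC).2
    -- The first splitting separates edges touching `C` from those avoiding it; the second separates
    -- edges inside `S` from `s(x, z)`, using `z ∉ S`.
    rw [expect_mul (A := E \ edgesAvoiding C E), expect_mul (A := S.sym2),
      expect_eq_indicator hxz, mul_comm (expect E p _) p]
    · refine mul_le_mul_of_nonneg_left (le_trans (expect_mono hp fun T _ => ?_) (hM z))
        (mul_nonneg hp.1 (expect_nonneg hp fun T _ => by positivity))
      exact_mod_cast Finset.card_le_card (edgeBall_mono (Finset.filter_subset _ _) z le_rfl)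
    · intro T _
      rw [clusterIn_inter_sym2]
    · intro T _
      simp [hz]
    · intro T hT
      have h1 := clusterIn_eq_iff_sdiff_edgesAvoiding (C := C) ho hT
      have h2 : s(x, z) ∈ T ↔ s(x, z) ∈ T ∩ (E \ edgesAvoiding C E) := by
        simp [mem_edgesAvoiding, hxz, hxC]
      simp only [← h1, ← h2]
    · intro T hT
      congr 3
      ext e
      have := @hT e
      simp only [mem_edgesAvoiding, Finset.mem_sdiff]
      tauto
  rw [expect_congr hdec, expect_sum]
  refine (Finset.sum_le_sum hC).trans ?_
  rw [← Finset.sum_mul, ← Finset.mul_sum, ← expect_sum, ← expect_mem_clusterIn hE hS]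
  refine le_of_eq ?_
  congr 2
  refine expect_congr fun T _ => ?_
  rw [Finset.sum_ite_eq]
  simp [clusterIn_subset]

lemma expect_card_edgeBall_le {E : Finset (Sym2 V)} (hE : (E : Set (Sym2 V)) ⊆ G.edgeSet)
    {S : Finset V} (hS : edgesInside G S ⊆ E) {o : V} (ho : o ∈ S) {p : ℝ} (hp : p ∈ Set.Icc 0 1)
    {r : ℕ} {M : ℝ} (hM : ∀ z, expect E p (fun T => ((edgeBall T z r).card : ℝ)) ≤ M) :
    expect E p (fun T => ((edgeBall T o r).card : ℝ)) ≤ S.card + expectedExits G p S o * M := by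
  refine (expect_mono hp fun T hT =>
    card_edgeBall_le (G := G) ((Finset.coe_subset.2 hT).trans hE) ho r).trans ?_
  rw [expect_add, expect_const, expect_sum]
  simp only [expect_sum]
  refine add_le_add_right ?_ _
  rw [expectedExits, Finset.sum_mul]
  refine Finset.sum_le_sum fun x _ => ?_
  rw [Finset.sum_mul]
  exact Finset.sum_le_sum fun z hz =>
    expect_exit_le hE hS ho hp hM (Finset.mem_sdiff.1 hz).2

lemma finite_setOf_walk (G : SimpleGraph V) [G.LocallyFinite] (o : V) (r : ℕ) :
    {y | ∃ w : G.Walk o y, w.length ≤ r}.Finite := by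
  induction r generalizing o with
  | zero =>
    refine (Set.finite_singleton o).subset ?_
    rintro y ⟨w, hw⟩
    cases w with
    | nil => rfl
    | cons _ _ => simp at hw
  | succ r ih =>
    refine ((Set.finite_singleton o).union
      ((G.neighborFinset o).finite_toSet.biUnion fun x _ => ih x)).subset ?_
    rintro y ⟨w, hw⟩
    cases w with
    | nil => exact Or.inl rfl
    | @cons _ x _ hadj w' =>
      refine Or.inr (Set.mem_biUnion (x := x) (by simpa using hadj) ⟨w', by simpa using hw⟩)

/-- The ball of radius `r` about `o` in `G`. -/
noncomputable def graphBall (G : SimpleGraph V) [G.LocallyFinite] (o : V) (r : ℕ) : Finset V :=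
  (finite_setOf_walk G o r).toFinset

lemma mem_graphBall {o y : V} {r : ℕ} :
    y ∈ graphBall G o r ↔ ∃ w : G.Walk o y, w.length ≤ r := by
  simp [graphBall]

omit [G.LocallyFinite] in
lemma edgeGraph_le {T : Finset (Sym2 V)} (hT : (T : Set (Sym2 V)) ⊆ G.edgeSet) :
    edgeGraph T ≤ G := by
  intro x y h
  exact hT (edgeGraph_adj.1 h).1

lemma edgeBall_subset_graphBall {T : Finset (Sym2 V)} (hT : (T : Set (Sym2 V)) ⊆ G.edgeSet)
    (o : V) (r : ℕ) : edgeBall T o r ⊆ graphBall G o r := by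
  intro y hy
  obtain ⟨w, hw⟩ := mem_edgeBall.1 hy
  exact mem_graphBall.2 ⟨w.mapLe (edgeGraph_le hT), by simpa using hw⟩

omit [G.LocallyFinite] in
lemma card_edgeBall_image (φ : G ≃g G) (T : Finset (Sym2 V)) (o : V) (r : ℕ) :
    (edgeBall (T.image (Sym2.map φ)) (φ o) r).card = (edgeBall T o r).card := by
  have h : edgeBall (T.image (Sym2.map φ)) (φ o) r = (edgeBall T o r).image φ := by
    have hadj : ∀ x y, (edgeGraph (T.image (Sym2.map φ))).Adj (φ x) (φ y) ↔
        (edgeGraph T).Adj x y := by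
      intro x y
      rw [edgeGraph_adj, edgeGraph_adj, ← Sym2.map_mk, φ.injective.ne_iff,
        Function.Injective.mem_finset_image (Sym2.map.injective φ.injective)]
    let ψ : edgeGraph T ≃g edgeGraph (T.image (Sym2.map φ)) := ⟨φ.toEquiv, fun {a b} => hadj a b⟩
    have hψ : ∀ x, ψ x = φ x := fun _ => rfl
    ext y
    simp only [mem_edgeBall, Finset.mem_image]
    constructor
    · rintro ⟨w, hw⟩
      refine ⟨ψ.symm y, ⟨(w.map ψ.symm.toHom).copy (ψ.symm_apply_apply o) rfl, by simpa using hw⟩, ?_⟩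
      exact ψ.apply_symm_apply y
    · rintro ⟨x, ⟨w, hw⟩, rfl⟩
      exact ⟨w.map ψ.toHom, by simpa using hw⟩
  rw [h, Finset.card_image_of_injective _ φ.injective]

omit [G.LocallyFinite] in
lemma expect_card_edgeBall_image (φ : G ≃g G) (E : Finset (Sym2 V)) (p : ℝ) (o : V) (r : ℕ) :
    expect (E.image (Sym2.map φ)) p (fun T => ((edgeBall T (φ o) r).card : ℝ)) =
      expect E p fun T => ((edgeBall T o r).card : ℝ) := by
  rw [expect_image (Sym2.map.injective φ.injective)]
  simp only [card_edgeBall_image]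

omit [G.LocallyFinite] in
lemma expect_card_edgeBall_mono {E E' : Finset (Sym2 V)} (h : E ⊆ E') {p : ℝ}
    (hp : p ∈ Set.Icc 0 1) (o : V) (r : ℕ) :
    expect E p (fun T => ((edgeBall T o r).card : ℝ)) ≤
      expect E' p fun T => ((edgeBall T o r).card : ℝ) := by
  rw [← expect_of_inter (F := fun T => ((edgeBall (T ∩ E) o r).card : ℝ)) h (by simp [Finset.inter_assoc])
    |>.trans (expect_congr fun T hT => by rw [Finset.inter_eq_left.2 hT])]
  refine expect_mono hp fun T _ => ?_
  exact_mod_cast Finset.card_le_card (edgeBall_mono Finset.inter_subset_left o le_rfl)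

/-- If the expected number of exits from some finite set is less than `1`, then the expected
sizes of the intrinsic balls are bounded uniformly in the radius. -/
lemma expect_card_edgeBall_le_div (hG : IsVertexTransitive G) {o : V} {S : Finset V} (ho : o ∈ S)
    {p : ℝ} (hp : p ∈ Set.Icc 0 1) (hφ : expectedExits G p S o < 1) (r : ℕ) {E : Finset (Sym2 V)}
    (hE : (E : Set (Sym2 V)) ⊆ G.edgeSet) :
    expect E p (fun T => ((edgeBall T o r).card : ℝ)) ≤ S.card / (1 - expectedExits G p S o) := by
  -- Taking the supremum over all finite edge sets makes it independent of the base vertex, by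
  -- transitivity. The deterministic ball makes it finite, so the recursion can be solved for it.
  let A : Set ℝ := {a | ∃ E : Finset (Sym2 V), (E : Set (Sym2 V)) ⊆ G.edgeSet ∧
    a = expect E p (fun T => ((edgeBall T o r).card : ℝ))}
  have hA : BddAbove A := by
    refine ⟨(graphBall G o r).card, ?_⟩
    rintro _ ⟨E, hE, rfl⟩
    rw [← expect_const E p ((graphBall G o r).card : ℝ)]
    refine expect_mono hp fun T hT => ?_
    exact_mod_cast Finset.card_le_card
      (edgeBall_subset_graphBall ((Finset.coe_subset.2 hT).trans hE) o r)
  have hle : ∀ E : Finset (Sym2 V), (E : Set (Sym2 V)) ⊆ G.edgeSet → ∀ z,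
      expect E p (fun T => ((edgeBall T z r).card : ℝ)) ≤ sSup A := by
    intro E hE z
    obtain ⟨φ, hφ⟩ := hG z o
    rw [← expect_card_edgeBall_image φ, hφ]
    refine le_csSup hA ⟨_, ?_, rfl⟩
    intro e he
    obtain ⟨e', he', rfl⟩ := Finset.mem_image.1 (Finset.mem_coe.1 he)
    have := hE he'
    induction e' using Sym2.ind with
    | _ x y => exact φ.map_adj_iff.2 this
  have key : sSup A ≤ S.card + expectedExits G p S o * sSup A := by
    refine csSup_le ⟨_, E, hE, rfl⟩ ?_
    rintro _ ⟨E, hE, rfl⟩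
    -- The recursion needs the edges inside `S` to be available; adding them only enlarges the
    -- balls.
    have hE' : ((E ∪ edgesInside G S : Finset (Sym2 V)) : Set (Sym2 V)) ⊆ G.edgeSet := by
      intro e he
      rcases Finset.mem_union.1 (Finset.mem_coe.1 he) with h | h
      · exact hE h
      · exact (Finset.mem_filter.1 h).2
    exact (expect_card_edgeBall_mono Finset.subset_union_left hp o r).trans
      (expect_card_edgeBall_le hE' Finset.subset_union_right ho hp (hle _ hE'))
  refine (hle E hE o).trans ?_
  rw [le_div_iff₀ (sub_pos.2 hφ)]
  linarith

end Subcritical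

/-! ### Many expected exits from every finite set: a differential inequality for escape. -/

section Supercritical

open scoped Classical

variable {V : Type*}

/-- The vertices of `L` which are not connected to the complement of `L` in the graph with edge
set `T`. -/
noncomputable def trapped (L : Finset V) (T : Finset (Sym2 V)) : Finset V :=
  L.filter fun x => ∀ y ∉ L, ¬ (edgeGraph T).Reachable x y

lemma mem_trapped {L : Finset V} {T : Finset (Sym2 V)} {x : V} :
    x ∈ trapped L T ↔ x ∈ L ∧ ∀ y ∉ L, ¬ (edgeGraph T).Reachable x y := by
  simp [trapped]

lemma trapped_subset (L : Finset V) (T : Finset (Sym2 V)) : trapped L T ⊆ L :=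
  Finset.filter_subset _ _

lemma trapped_anti (L : Finset V) {T U : Finset (Sym2 V)} (h : T ⊆ U) :
    trapped L U ⊆ trapped L T := by
  intro x hx
  rw [mem_trapped] at *
  exact ⟨hx.1, fun y hy hr => hx.2 y hy (hr.mono (edgeGraph_mono h))⟩

/-- After its last visit to `S`, the walk uses no edge with both ends in `S`. -/
lemma exists_exit_sdiff_sym2 {T : Finset (Sym2 V)} {S : Finset V} {v y : V}
    (w : (edgeGraph T).Walk v y) (hy : y ∉ S) :
    (v ∉ S ∧ (edgeGraph (T \ S.sym2)).Reachable v y) ∨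
      ∃ a ∈ S, (edgeGraph (T \ S.sym2)).Reachable a y := by
  induction w with
  | nil => exact Or.inl ⟨hy, .rfl⟩
  | @cons v b y hadj w ih =>
    rcases ih hy with ⟨hb, h⟩ | h
    · have hvb : (edgeGraph (T \ S.sym2)).Adj v b := by
        rw [edgeGraph_adj] at *
        simp [hadj, hb]
      by_cases hv : v ∈ S
      · exact Or.inr ⟨v, hv, hvb.reachable.trans h⟩
      · exact Or.inl ⟨hv, hvb.reachable.trans h⟩
    · exact Or.inr h

/-- The trapped set can be found by exploring from outside `L`, without looking at the edges inside
it. This makes it independent of the connections within `S`. -/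
lemma trapped_eq_iff_sdiff_sym2 {L S : Finset V} (hS : S ⊆ L) (T : Finset (Sym2 V)) :
    trapped L T = S ↔ trapped L (T \ S.sym2) = S := by
  have hsub := trapped_anti L (Finset.sdiff_subset : T \ S.sym2 ⊆ T)
  constructor
  · intro h
    refine Finset.Subset.antisymm (fun v hv => ?_) (h ▸ hsub)
    by_contra hvS
    rw [mem_trapped] at hv
    have hv' : v ∉ trapped L T := h.symm ▸ hvS
    rw [mem_trapped] at hv'
    push Not at hv'
    obtain ⟨y, hy, ⟨w⟩⟩ := hv' hv.1
    rcases exists_exit_sdiff_sym2 w (fun h => hy (hS h)) with ⟨-, h'⟩ | ⟨a, ha, h'⟩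
    · exact hv.2 y hy h'
    · rw [← h, mem_trapped] at ha
      exact ha.2 y hy (h'.mono (edgeGraph_mono Finset.sdiff_subset))
  · intro h
    refine Finset.Subset.antisymm (h ▸ hsub) (fun v hv => ?_)
    rw [mem_trapped]
    refine ⟨hS hv, fun y hy ⟨w⟩ => ?_⟩
    rcases exists_exit_sdiff_sym2 w (fun h => hy (hS h)) with ⟨h', -⟩ | ⟨a, ha, h'⟩
    · exact h' hv
    · rw [← h, mem_trapped] at ha
      exact ha.2 y hy h'

variable {G : SimpleGraph V} [G.LocallyFinite]

/-- The edges of `G` with an endpoint in `L`. -/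
noncomputable def edgesTouching (G : SimpleGraph V) [G.LocallyFinite] (L : Finset V) :
    Finset (Sym2 V) :=
  L.biUnion fun x => (G.neighborFinset x).image fun y => s(x, y)

lemma mem_edgesTouching {L : Finset V} {x y : V} (hx : x ∈ L) (h : G.Adj x y) :
    s(x, y) ∈ edgesTouching G L := by
  simp only [edgesTouching, Finset.mem_biUnion, Finset.mem_image, SimpleGraph.mem_neighborFinset]
  exact ⟨x, hx, y, h, rfl⟩

lemma edgesTouching_subset (L : Finset V) : (edgesTouching G L : Set (Sym2 V)) ⊆ G.edgeSet := by
  intro e he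
  simp only [edgesTouching, Finset.coe_biUnion, Set.mem_iUnion, Finset.coe_image, Set.mem_image,
    Finset.mem_coe, SimpleGraph.mem_neighborFinset] at he
  obtain ⟨x, -, y, h, rfl⟩ := he
  exact h

lemma edgesInside_subset_edgesTouching {S L : Finset V} (h : S ⊆ L) :
    edgesInside G S ⊆ edgesTouching G L := by
  intro e he
  induction e using Sym2.ind with
  | _ x y =>
    simp only [edgesInside, Finset.mem_filter, Finset.mk_mem_sym2_iff] at he
    exact mem_edgesTouching (h he.1.1) he.2

/-- The number of edges leaving the trapped region whose inner endpoint is connected to `o` inside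
the region bounds from below the number of pivotal edges. -/
lemma sum_pivotal_le {L : Finset V} {o : V} {T : Finset (Sym2 V)} (ho : o ∈ trapped L T) :
    ∑ e ∈ edgesTouching G L, ((if o ∈ trapped L (insert e T) then (1 : ℝ) else 0) -
        if o ∈ trapped L (T.erase e) then 1 else 0) ≤
      - ∑ x ∈ trapped L T, ∑ _y ∈ G.neighborFinset x \ trapped L T,
        if x ∈ clusterIn (trapped L T) o T then (1 : ℝ) else 0 := by
  set S := trapped L T with hS
  let P : Finset (Σ _ : V, V) :=
    (S.filter (· ∈ clusterIn S o T)).sigma fun x => G.neighborFinset x \ S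
  have hP : ∀ q ∈ P, q.1 ∈ S ∧ q.1 ∈ clusterIn S o T ∧ G.Adj q.1 q.2 ∧ q.2 ∉ S := by
    intro q hq
    simpa [P, and_assoc] using hq
  -- The orientation of a boundary edge is recovered from the end lying in `S`.
  have hinj : Set.InjOn (fun q : Σ _ : V, V => s(q.1, q.2)) (P : Set (Σ _ : V, V)) := by
    rintro ⟨x, y⟩ hq ⟨x', y'⟩ hq' h
    obtain ⟨h1, -, -, h2⟩ := hP _ hq
    obtain ⟨h3, -, -, h4⟩ := hP _ hq'
    simp only [Sym2.eq_iff] at h h1 h2 h3 h4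
    rcases h with ⟨rfl, rfl⟩ | ⟨rfl, rfl⟩
    · rfl
    · exact absurd h3 h2
  -- Opening the edge joins `o` to `y`, which is outside `L` or connected to its complement; closing
  -- an edge keeps `o` trapped.
  have hpiv : ∀ q ∈ P, (if o ∈ trapped L (insert s(q.1, q.2) T) then (1 : ℝ) else 0) -
      (if o ∈ trapped L (T.erase s(q.1, q.2)) then 1 else 0) = -1 := by
    rintro ⟨x, y⟩ hq
    obtain ⟨hx, hxo, hxy, hy⟩ := hP _ hq
    simp only at hx hxo hxy hy ⊢
    rw [if_pos (trapped_anti L (Finset.erase_subset _ _) ho), if_neg, zero_sub]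
    intro h
    rw [mem_trapped] at h
    have hle : edgeGraph T ≤ edgeGraph (insert s(x, y) T) := edgeGraph_mono (Finset.subset_insert _ _)
    have hoy : (edgeGraph (insert s(x, y) T)).Reachable o y :=
      ((mem_clusterIn.1 hxo).2.mono ((edgeGraph_mono Finset.inter_subset_left).trans hle)).trans
        (SimpleGraph.Adj.reachable (edgeGraph_adj.2 ⟨Finset.mem_insert_self _ _, hxy.ne⟩))
    by_cases hyL : y ∈ L
    · rw [hS, mem_trapped] at hy
      push Not at hy
      obtain ⟨z, hz, hyz⟩ := hy hyL
      exact h.2 z hz (hoy.trans (hyz.mono hle))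
    · exact h.2 y hyL hoy
  have hcard : ∑ x ∈ S, ∑ _y ∈ G.neighborFinset x \ S,
      (if x ∈ clusterIn S o T then (1 : ℝ) else 0) = ∑ _q ∈ P, 1 := by
    rw [Finset.sum_sigma, Finset.sum_filter]
    refine Finset.sum_congr rfl fun x _ => ?_
    split_ifs <;> simp
  rw [hcard, ← Finset.sum_neg_distrib, ← Finset.sum_congr rfl hpiv, ← Finset.sum_image
    (f := fun e => (if o ∈ trapped L (insert e T) then (1 : ℝ) else 0) -
      if o ∈ trapped L (T.erase e) then 1 else 0) hinj]
  rw [← neg_le_neg_iff, ← Finset.sum_neg_distrib, ← Finset.sum_neg_distrib]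
  -- Being trapped is a decreasing event, so the edges left out contribute with the favourable sign.
  refine Finset.sum_le_sum_of_subset_of_nonneg ?_ fun e _ _ => ?_
  · intro e he
    obtain ⟨q, hq, rfl⟩ := Finset.mem_image.1 he
    obtain ⟨hx, -, hxy, -⟩ := hP q hq
    exact mem_edgesTouching (trapped_subset L T hx) hxy
  · have := @trapped_anti V L _ _ ((Finset.erase_subset e T).trans (Finset.subset_insert e T)) o
    split_ifs <;> simp_all

/-- The differential inequality of Duminil-Copin and Tassion. -/
lemma sum_expect_trapped_le {L : Finset V} {o : V} {p : ℝ} (hp : p ∈ Set.Icc 0 1)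
    (hφ : ∀ S : Finset V, o ∈ S → 1 ≤ expectedExits G p S o) :
    ∑ e ∈ edgesTouching G L, expect (edgesTouching G L) p (fun T =>
      (if o ∈ trapped L (insert e T) then (1 : ℝ) else 0) -
        if o ∈ trapped L (T.erase e) then 1 else 0) ≤
    - expect (edgesTouching G L) p fun T => if o ∈ trapped L T then 1 else 0 := by
  set E := edgesTouching G L
  rw [← expect_sum]
  -- Split according to the value `S` of the trapped set, so that independence applies for each
  -- fixed `S`.
  have hpt : ∀ T ⊆ E, (∑ e ∈ E, ((if o ∈ trapped L (insert e T) then (1 : ℝ) else 0) -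
      if o ∈ trapped L (T.erase e) then 1 else 0)) ≤
      ∑ S ∈ L.powerset.filter (o ∈ ·), (-1) * ∑ x ∈ S, ∑ _y ∈ G.neighborFinset x \ S,
        ((if x ∈ clusterIn S o T then (1 : ℝ) else 0) * if trapped L T = S then 1 else 0) := by
    intro T _
    by_cases ho : o ∈ trapped L T
    · refine (sum_pivotal_le ho).trans (le_of_eq ?_)
      rw [Finset.sum_eq_single_of_mem (trapped L T) (by simp [ho, trapped_subset])]
      · simp
      · intro S _ hS
        simp [hS.symm]
    · rw [Finset.sum_eq_zero (s := L.powerset.filter (o ∈ ·))]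
      · refine Finset.sum_nonpos fun e _ => ?_
        have := @trapped_anti V L _ _ ((Finset.erase_subset e T).trans (Finset.subset_insert e T)) o
        split_ifs <;> simp_all
      · intro S hS
        have : trapped L T ≠ S := fun h => ho (h ▸ (Finset.mem_filter.1 hS).2)
        simp [this]
  refine (expect_mono hp hpt).trans ?_
  have hS : ∀ S ∈ L.powerset.filter (o ∈ ·),
      expect E p (fun T => (-1) * ∑ x ∈ S, ∑ _y ∈ G.neighborFinset x \ S,
        ((if x ∈ clusterIn S o T then (1 : ℝ) else 0) * if trapped L T = S then 1 else 0)) ≤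
      -expect E p (fun T => if trapped L T = S then 1 else 0) := by
    intro S hS
    obtain ⟨hSL, hoS⟩ := Finset.mem_filter.1 hS
    rw [Finset.mem_powerset] at hSL
    have hind : ∀ x ∈ S, expect E p (fun T => (if x ∈ clusterIn S o T then (1 : ℝ) else 0) *
        if trapped L T = S then 1 else 0) =
        connProbIn G p S o x * expect E p (fun T => if trapped L T = S then 1 else 0) := by
      intro x _
      rw [expect_mul (A := S.sym2), expect_mem_clusterIn (edgesTouching_subset L)
        (edgesInside_subset_edgesTouching hSL)]
      · intro T _
        rw [clusterIn_inter_sym2]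
      · intro T _
        simp only [trapped_eq_iff_sdiff_sym2 hSL T]
    have h0 : 0 ≤ expect E p (fun T => if trapped L T = S then 1 else 0) :=
      expect_nonneg hp fun T _ => by positivity
    rw [expect_const_mul, neg_one_mul, neg_le_neg_iff, expect_sum]
    simp only [expect_sum]
    calc expect E p (fun T => if trapped L T = S then 1 else 0)
        ≤ expectedExits G p S o * expect E p (fun T => if trapped L T = S then 1 else 0) :=
          le_mul_of_one_le_left h0 (hφ S hoS)
      _ ≤ _ := by
        rw [expectedExits, Finset.sum_mul]
        refine Finset.sum_le_sum fun x hx => ?_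
        rw [Finset.sum_mul]
        refine Finset.sum_le_sum fun y _ => ?_
        rw [hind x hx]
        refine mul_le_mul_of_nonneg_right ?_ h0
        -- `expectedExits` carries a factor `p` absent from the count of pivotal edges; `p ≤ 1` lets
        -- it be dropped.
        exact mul_le_of_le_one_left (connProbIn_nonneg hp _ _ _) hp.2
  rw [expect_sum]
  refine (Finset.sum_le_sum hS).trans (le_of_eq ?_)
  rw [Finset.sum_neg_distrib, ← expect_sum]
  congr 1
  refine expect_congr fun T _ => ?_
  rw [Finset.sum_ite_eq]
  simp [trapped_subset]

/-- From u' ≤ -u, the product u(p) e^p is nonincreasing, and u(p₀) ≤ 1. The bound does not depend on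
`L`, which allows `L` to exhaust the cluster. -/
lemma expect_trapped_le_exp {o : V} {p₀ p₁ : ℝ} (h0 : 0 ≤ p₀) (h01 : p₀ ≤ p₁) (h1 : p₁ ≤ 1)
    (hφ : ∀ p ∈ Set.Icc p₀ p₁, ∀ S : Finset V, o ∈ S → 1 ≤ expectedExits G p S o)
    (L : Finset V) :
    expect (edgesTouching G L) p₁ (fun T => if o ∈ trapped L T then (1 : ℝ) else 0) ≤
      Real.exp (-(p₁ - p₀)) := by
  set E := edgesTouching G L
  set F : Finset (Sym2 V) → ℝ := fun T => if o ∈ trapped L T then (1 : ℝ) else 0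
  have hder : ∀ p, HasDerivAt (fun q => expect E q F * Real.exp q)
      ((∑ e ∈ E, expect E p fun T => F (insert e T) - F (T.erase e)) * Real.exp p +
        expect E p F * Real.exp p) p :=
    fun p => (hasDerivAt_expect E F p).mul (Real.hasDerivAt_exp p)
  have hanti : AntitoneOn (fun q => expect E q F * Real.exp q) (Set.Icc p₀ p₁) := by
    refine antitoneOn_of_deriv_nonpos (convex_Icc _ _)
      (fun p _ => (hder p).continuousAt.continuousWithinAt)
      (fun p _ => (hder p).differentiableAt.differentiableWithinAt) fun p hp => ?_
    have hp' := interior_subset hp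
    rw [(hder p).deriv, ← add_mul]
    refine mul_nonpos_of_nonpos_of_nonneg ?_ (Real.exp_pos p).le
    have := sum_expect_trapped_le (L := L) ⟨h0.trans hp'.1, hp'.2.trans h1⟩ (hφ p hp')
    linarith
  have h := hanti (Set.left_mem_Icc.2 h01) (Set.right_mem_Icc.2 h01) h01
  have hle : expect E p₀ F ≤ 1 := by
    rw [← expect_const E p₀ 1]
    refine expect_mono ⟨h0, h01.trans h1⟩ fun T _ => ?_
    simp only [F]
    split_ifs <;> norm_num
  rw [neg_sub, Real.exp_sub, le_div_iff₀ (Real.exp_pos _)]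
  exact h.trans (mul_le_of_le_one_left (Real.exp_pos _).le hle)

end Supercritical

/-! ### From finite edge sets to the product measure, and criticality. -/

section Infinite

open scoped Classical

variable {V : Type*} {G : SimpleGraph V}

instance (p : I) : IsProbabilityMeasure (bondMeasure G p) := by
  unfold bondMeasure; infer_instance

/-- The edges of `E` that are open in the configuration `ω`. -/
noncomputable def openEdges (E : Finset (Sym2 V)) (ω : Config G) : Finset (Sym2 V) :=
  E.filter fun e => ∃ h : e ∈ G.edgeSet, ω ⟨e, h⟩ = true

lemma setOf_openEdges_eq {E T : Finset (Sym2 V)} (hE : (E : Set (Sym2 V)) ⊆ G.edgeSet)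
    (hT : T ⊆ E) : {ω : Config G | openEdges E ω = T} =
      Set.pi (E.subtype (· ∈ G.edgeSet) : Finset G.edgeSet)
        fun e => if e.1 ∈ T then {true} else {false} := by
  ext ω
  simp only [Set.mem_ofPred_eq, Set.mem_pi, Finset.mem_coe, Finset.mem_subtype]
  constructor
  · rintro h ⟨e, he⟩ heE
    have : e ∈ T ↔ ω ⟨e, he⟩ = true := by
      rw [← h]
      simp [openEdges, he, show e ∈ E from heE]
    split_ifs with h' <;> simp_all
  · intro h
    ext e
    by_cases heE : e ∈ E
    · have := h ⟨e, hE heE⟩ heE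
      have he := hE heE
      split_ifs at this with h' <;> simp_all [openEdges]
    · have : e ∉ T := fun h => heE (hT h)
      simp [openEdges, heE, this]

lemma measurableSet_openEdges_eq {E T : Finset (Sym2 V)} (hE : (E : Set (Sym2 V)) ⊆ G.edgeSet)
    (hT : T ⊆ E) : MeasurableSet {ω : Config G | openEdges E ω = T} := by
  rw [setOf_openEdges_eq hE hT]
  exact MeasurableSet.pi (Finset.countable_toSet _) fun _ _ => MeasurableSet.of_discrete

lemma bondMeasure_openEdges_eq {E T : Finset (Sym2 V)} (hE : (E : Set (Sym2 V)) ⊆ G.edgeSet)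
    (hT : T ⊆ E) (p : I) : bondMeasure G p {ω | openEdges E ω = T} =
      ENNReal.ofReal ((p : ℝ) ^ T.card * (1 - p) ^ (E \ T).card) := by
  have hB : ∀ e : G.edgeSet, ProbabilityTheory.bernoulliMeasure true false p
      (if e.1 ∈ T then {true} else {false}) =
        ENNReal.ofReal (if e.1 ∈ T then (p : ℝ) else 1 - p) := by
    intro e
    rw [← ENNReal.ofReal_toReal (measure_ne_top _ _), ← measureReal_def,
      ProbabilityTheory.bernoulliMeasure_real_apply p MeasurableSet.of_discrete]
    split_ifs <;> simp_all
  have h0 : ∀ e : Sym2 V, 0 ≤ (if e ∈ T then (p : ℝ) else 1 - p) := by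
    intro e
    have := p.2.1
    have := p.2.2
    split_ifs <;> linarith
  rw [setOf_openEdges_eq hE hT, bondMeasure, Measure.infinitePi_pi _ fun _ _ => MeasurableSet.of_discrete,
    Finset.prod_congr rfl fun e _ => hB e, ← ENNReal.ofReal_prod_of_nonneg fun (e : G.edgeSet) _ => h0 e]
  congr 1
  have hprod := Finset.prod_map (E.subtype (· ∈ G.edgeSet)) (Function.Embedding.subtype _)
    fun e => if e ∈ T then (p : ℝ) else 1 - p
  rw [Finset.subtype_map_of_mem fun e he => hE he] at hprod
  refine hprod.symm.trans ?_
  rw [Finset.prod_ite, Finset.prod_const, Finset.prod_const, Finset.filter_mem_eq_inter,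
    Finset.inter_eq_right.2 hT, Finset.filter_notMem_eq_sdiff]

/-- The bridge between the product measure and the finite sums: an integrand depending on finitely
many edges is decomposed over their cylinder events. -/
lemma lintegral_openEdges {E : Finset (Sym2 V)} (hE : (E : Set (Sym2 V)) ⊆ G.edgeSet) (p : I)
    {F : Finset (Sym2 V) → ℝ} (hF : ∀ T, 0 ≤ F T) :
    ∫⁻ ω, ENNReal.ofReal (F (openEdges E ω)) ∂(bondMeasure G p) =
      ENNReal.ofReal (expect E p F) := by
  have hdec : ∀ ω : Config G, ENNReal.ofReal (F (openEdges E ω)) = ∑ T ∈ E.powerset,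
      {ω | openEdges E ω = T}.indicator (fun _ => ENNReal.ofReal (F T)) ω := by
    intro ω
    rw [Finset.sum_eq_single_of_mem (openEdges E ω)
      (Finset.mem_powerset.2 (Finset.filter_subset _ _))]
    · simp
    · intro T _ hT
      exact Set.indicator_of_notMem (fun h => hT h.symm) _
  have hp0 := p.2.1
  have hp1 := sub_nonneg.2 p.2.2
  simp_rw [hdec]
  rw [lintegral_finsetSum' _ fun T hT => (measurable_const.indicator
      (measurableSet_openEdges_eq hE (Finset.mem_powerset.1 hT))).aemeasurable, expect,
    ENNReal.ofReal_sum_of_nonneg fun T _ => by have := hF T; positivity]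
  refine Finset.sum_congr rfl fun T hT => ?_
  rw [lintegral_indicator_const (measurableSet_openEdges_eq hE (Finset.mem_powerset.1 hT)),
    bondMeasure_openEdges_eq hE (Finset.mem_powerset.1 hT), mul_comm,
    ← ENNReal.ofReal_mul (by positivity)]

lemma edgeGraph_openEdges_le (E : Finset (Sym2 V)) (ω : Config G) :
    edgeGraph (openEdges E ω) ≤ openGraph G ω := by
  intro x y h
  exact (Finset.mem_filter.1 (edgeGraph_adj.1 h).1).2

lemma openGraph_le (ω : Config G) : openGraph G ω ≤ G := fun _ _ h => h.1

lemma edist_le_iff_exists_walk {H : SimpleGraph V} {x y : V} {r : ℕ} :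
    H.edist x y ≤ r ↔ ∃ w : H.Walk x y, w.length ≤ r := by
  constructor
  · intro h
    obtain ⟨w, hw⟩ := SimpleGraph.exists_walk_of_edist_ne_top
      (ne_top_of_le_ne_top (ENat.natCast_ne_top r) h)
    exact ⟨w, by exact_mod_cast hw.trans_le h⟩
  · rintro ⟨w, hw⟩
    exact w.edist_le.trans (by exact_mod_cast hw)

lemma coe_edgesInside_subset (S : Finset V) : (edgesInside G S : Set (Sym2 V)) ⊆ G.edgeSet :=
  fun _ he => (Finset.mem_filter.1 (Finset.mem_coe.1 he)).2

variable [G.LocallyFinite]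

/-- An open path of length at most `r` from `o` stays in the ball of `G`, which is finite by local
finiteness. -/
lemma chemBall_eq (ω : Config G) (o : V) (r : ℕ) : chemBall G ω o r =
    edgeBall (openEdges (edgesInside G (graphBall G o r)) ω) o r := by
  ext y
  rw [chemBall, Set.mem_ofPred_eq, chemDist, edist_le_iff_exists_walk, Finset.mem_coe, mem_edgeBall]
  constructor
  · rintro ⟨w, hw⟩
    have hsupp : ∀ v ∈ w.support, v ∈ graphBall G o r := by
      intro v hv
      refine mem_graphBall.2 ⟨(w.takeUntil v hv).mapLe (openGraph_le ω), ?_⟩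
      simpa using (w.length_takeUntil_le_length hv).trans hw
    refine ⟨w.transfer _ fun e he => ?_, by simpa using hw⟩
    have he' := w.edges_subset_edgeSet he
    induction e using Sym2.ind with
    | _ a b =>
      have hadj : (openGraph G ω).Adj a b := he'
      rw [SimpleGraph.mem_edgeSet, edgeGraph_adj]
      refine ⟨Finset.mem_filter.2 ⟨Finset.mem_filter.2 ⟨?_, hadj.1⟩, hadj⟩, hadj.ne⟩
      exact Finset.mk_mem_sym2_iff.2 ⟨hsupp _ (w.fst_mem_support_of_mem_edges he),
        hsupp _ (w.snd_mem_support_of_mem_edges he)⟩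
  · rintro ⟨w, hw⟩
    exact ⟨w.mapLe (edgeGraph_openEdges_le _ ω), by simpa using hw⟩

lemma expectedChemBall_eq (p : I) (o : V) (r : ℕ) : expectedChemBall G p o r = ENNReal.ofReal
    (expect (edgesInside G (graphBall G o r)) p fun T => ((edgeBall T o r).card : ℝ)) := by
  rw [← lintegral_openEdges (coe_edgesInside_subset _) p fun T => by positivity, expectedChemBall]
  refine lintegral_congr fun ω => ?_
  rw [chemBall_eq, Set.encard_coe_eq_coe_finsetCard, ENNReal.ofReal_natCast]
  rfl

lemma graphBall_mono (o : V) : Monotone (graphBall G o) := by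
  intro r s h y hy
  obtain ⟨w, hw⟩ := mem_graphBall.1 hy
  exact mem_graphBall.2 ⟨w, hw.trans h⟩

/-- A finite cluster lies in all large balls about `o`, so `o` is trapped in them; each such event
has probability at most `c`. -/
lemma bondMeasure_infinite_ne_zero {o : V} {p : I} {c : ℝ} (hc : c < 1)
    (h : ∀ L : Finset V, expect (edgesTouching G L) p
      (fun T => if o ∈ trapped L T then (1 : ℝ) else 0) ≤ c) :
    bondMeasure G p {ω | (cluster G ω o).Infinite} ≠ 0 := by
  let B : ℕ → Set (Config G) := fun n =>
    {ω | o ∈ trapped (graphBall G o n) (openEdges (edgesTouching G (graphBall G o n)) ω)}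
  have hB : ∀ n, bondMeasure G p (B n) ≤ ENNReal.ofReal c := by
    intro n
    refine le_trans (le_of_eq ?_) (ENNReal.ofReal_le_ofReal (h (graphBall G o n)))
    rw [← lintegral_openEdges (edgesTouching_subset _) p fun T => by positivity]
    have hm : MeasurableSet (B n) := by
      have : B n = ⋃ T ∈ (edgesTouching G (graphBall G o n)).powerset.filter
          (o ∈ trapped (graphBall G o n) ·),
          {ω | openEdges (edgesTouching G (graphBall G o n)) ω = T} := by
        ext ω
        simp [B, openEdges, Finset.filter_subset]
      rw [this]
      exact Finset.measurableSet_biUnion _ fun T hT => measurableSet_openEdges_eq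
        (edgesTouching_subset _) (Finset.mem_powerset.1 (Finset.mem_filter.1 hT).1)
    rw [← lintegral_indicator_one hm]
    refine lintegral_congr fun ω => ?_
    change (B n).indicator 1 ω = ENNReal.ofReal (if ω ∈ B n then 1 else 0)
    by_cases hω : ω ∈ B n
    · rw [Set.indicator_of_mem hω, if_pos hω]
      simp
    · rw [Set.indicator_of_notMem hω, if_neg hω]
      simp
  -- Intersecting over `m ≥ n` gives an increasing union, whose measure is a supremum bounded by
  -- `c`.
  have hfin : {ω | (cluster G ω o).Infinite}ᶜ ⊆ ⋃ n, ⋂ m ≥ n, B m := by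
    intro ω hω
    have hω' : (cluster G ω o).Finite := by simpa using hω
    have hex : ∀ y ∈ cluster G ω o, ∃ n, y ∈ graphBall G o n := by
      rintro y ⟨w⟩
      exact ⟨_, mem_graphBall.2 ⟨w.mapLe (openGraph_le ω), le_rfl⟩⟩
    obtain ⟨n, hn⟩ : ∃ n, ∀ y ∈ cluster G ω o, y ∈ graphBall G o n := by
      choose! f hf using hex
      refine ⟨hω'.toFinset.sup f, fun y hy => graphBall_mono o ?_ (hf y hy)⟩
      exact Finset.le_sup (f := f) (hω'.mem_toFinset.2 hy)
    simp only [Set.mem_iUnion, Set.mem_iInter]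
    refine ⟨n, fun m hm => mem_trapped.2 ⟨mem_graphBall.2 ⟨.nil, by simp⟩, fun y hy hr => hy ?_⟩⟩
    exact graphBall_mono o hm (hn y (hr.mono (edgeGraph_openEdges_le _ ω)))
  have hU : bondMeasure G p (⋃ n, ⋂ m ≥ n, B m) ≤ ENNReal.ofReal c := by
    rw [Monotone.measure_iUnion]
    · exact iSup_le fun n => (measure_mono (Set.iInter₂_subset n le_rfl)).trans (hB n)
    · intro a b hab
      exact Set.biInter_mono (fun m hm => le_trans hab hm) fun _ _ => le_rfl
  intro h0
  -- Only subadditivity is used, so measurability of the infinite-cluster event is not needed.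
  have h1 : (1 : ℝ≥0∞) ≤ ENNReal.ofReal c := by
    rw [← measure_univ (μ := bondMeasure G p),
      ← Set.union_compl_self {ω : Config G | (cluster G ω o).Infinite}]
    refine (measure_union_le _ _).trans ?_
    rw [h0, zero_add]
    exact (measure_mono hfin).trans hU
  rw [ENNReal.one_le_ofReal] at h1
  linarith

-- Each vertex of the ball is reached by an open path of length at most `r`, all of whose edges
-- survive the thinning with probability at least `q ^ r`.
omit [G.LocallyFinite] in
lemma pow_mul_expect_card_edgeBall_le (E : Finset (Sym2 V)) {p q : ℝ} (hp : p ∈ Set.Icc 0 1)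
    (hq : q ∈ Set.Icc 0 1) (o : V) (r : ℕ) :
    q ^ r * expect E p (fun T => ((edgeBall T o r).card : ℝ)) ≤
      expect E (p * q) fun T => ((edgeBall T o r).card : ℝ) := by
  rw [← expect_thinning, ← expect_const_mul]
  refine expect_mono hp fun T _ => ?_
  calc q ^ r * ((edgeBall T o r).card : ℝ) = ∑ _y ∈ edgeBall T o r, q ^ r := by
        rw [Finset.sum_const, nsmul_eq_mul, mul_comm]
    _ ≤ ∑ y ∈ edgeBall T o r, expect T q (fun U => if y ∈ edgeBall U o r then 1 else 0) := by
        refine Finset.sum_le_sum fun y hy => ?_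
        obtain ⟨w, hw⟩ := mem_edgeBall.1 hy
        have hsub : w.edges.toFinset ⊆ T := by
          intro e he
          have := w.edges_subset_edgeSet (List.mem_toFinset.1 he)
          simp only [edgeGraph, SimpleGraph.edgeSet_fromEdgeSet] at this
          exact this.1
        -- A walk may repeat edges, which only reduces the number of edges that must survive.
        have hcard : w.edges.toFinset.card ≤ r :=
          (List.toFinset_card_le _).trans (by simpa using hw)
        refine (pow_le_pow_of_le_one hq.1 hq.2 hcard).trans
          (pow_le_expect_superset hsub hq (fun U _ hU => ?_) fun U _ => by positivity)
        rw [if_pos]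
        refine mem_edgeBall.2 ⟨w.transfer _ fun e he => ?_, by simpa using hw⟩
        have h := w.edges_subset_edgeSet he
        simp only [edgeGraph, SimpleGraph.edgeSet_fromEdgeSet] at h ⊢
        exact ⟨hU (List.mem_toFinset.2 he), h.2⟩
    _ = expect T q (fun U => ∑ y ∈ edgeBall T o r, if y ∈ edgeBall U o r then 1 else 0) := by
        rw [expect_sum]
    _ ≤ expect T q (fun U => ((edgeBall U o r).card : ℝ)) := by
        refine expect_mono hq fun U _ => ?_
        rw [← Finset.sum_filter, Finset.sum_const, nsmul_eq_mul, mul_one]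
        exact_mod_cast Finset.card_le_card fun y hy => (Finset.mem_filter.1 hy).2

/-- At criticality, the expected size of the intrinsic ball has no exponential growth. -/
lemma expect_criticalProb_le_exp (hG : IsVertexTransitive G) (o : V) {ε : ℝ} (hε : 0 < ε) :
    ∃ C : ℝ, ∀ r : ℕ, expect (edgesInside G (graphBall G o r)) (criticalProb G o)
      (fun T => ((edgeBall T o r).card : ℝ)) ≤ C * Real.exp (ε * r) := by
  set pc := criticalProb G o with hpc
  suffices h : ∃ p : ℝ, 0 ≤ p ∧ p ≤ pc ∧ pc * Real.exp (-ε) ≤ p ∧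
      ∃ S : Finset V, o ∈ S ∧ expectedExits G p S o < 1 by
    obtain ⟨p, hp0, hp, hpe, S, hoS, hS⟩ := h
    refine ⟨S.card / (1 - expectedExits G p S o), fun r => ?_⟩
    have hp01 : p ∈ Set.Icc (0 : ℝ) 1 := ⟨hp0, hp.trans pc.2.2⟩
    have hb := expect_card_edgeBall_le_div hG hoS hp01 hS r
      (coe_edgesInside_subset (graphBall G o r))
    -- The retention probability is `p / pc`, or `1` when `pc = 0`.
    obtain ⟨q, hq, hpq, hqe⟩ : ∃ q ∈ Set.Icc (0 : ℝ) 1, pc * q = p ∧ Real.exp (-ε) ≤ q := by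
      rcases eq_or_lt_of_le pc.2.1 with h0 | h0
      · have h0' : (pc : ℝ) = 0 := h0.symm
        refine ⟨1, by simp, ?_, by simpa using hε.le⟩
        rw [h0'] at hp ⊢
        linarith
      · have h0' : (0 : ℝ) < pc := h0
        exact ⟨p / pc, ⟨by positivity, div_le_one_of_le₀ hp h0'.le⟩, by field_simp,
          by rwa [le_div_iff₀ h0', mul_comm]⟩
    have ht := pow_mul_expect_card_edgeBall_le (edgesInside G (graphBall G o r)) pc.2 hq o r
    rw [hpq] at ht
    have hN : 0 ≤ expect (edgesInside G (graphBall G o r)) pc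
        (fun T => ((edgeBall T o r).card : ℝ)) := expect_nonneg pc.2 fun T _ => by positivity
    have hpow : Real.exp (-(ε * r)) ≤ q ^ r := by
      rw [show -(ε * r) = r * (-ε) by ring, Real.exp_nat_mul]
      exact pow_le_pow_left₀ (Real.exp_pos _).le hqe r
    have h := (mul_le_mul_of_nonneg_right hpow hN).trans (ht.trans hb)
    rw [Real.exp_neg, inv_mul_eq_div, div_le_iff₀ (Real.exp_pos _)] at h
    exact h
  rcases eq_or_lt_of_le pc.2.1 with h0 | h0
  -- At `p = 0` no exit is open, so any finite set containing `o` would do.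
  · have h0' : (pc : ℝ) = 0 := h0.symm
    refine ⟨0, le_rfl, h0'.ge, by simp [h0'], {o}, by simp, ?_⟩
    simp [expectedExits]
  · have h0' : (0 : ℝ) < pc := h0
    have hlt : (pc : ℝ) * Real.exp (-ε) < pc :=
      mul_lt_of_lt_one_right h0' (by simpa using hε)
    have hpos : (0 : ℝ) ≤ pc * Real.exp (-ε) := by positivity
    let p₀ : I := ⟨pc * Real.exp (-ε), hpos, hlt.le.trans pc.2.2⟩
    have hp₀ : p₀ < sSup {p : I | bondMeasure G p {ω | (cluster G ω o).Infinite} = 0} := hlt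
    obtain ⟨p₁, hp₁, hp₀₁⟩ := lt_sSup_iff.1 hp₀
    have hp₁c : p₁ ≤ pc := le_sSup hp₁
    have h01 : (p₀ : ℝ) < p₁ := hp₀₁
    by_contra hcon
    push Not at hcon
    -- Otherwise all φ_p(S) ≥ 1 on `[p₀, p₁]`, giving an infinite cluster with positive probability
    -- at `p₁`, which was chosen from the set defining `pc`.
    refine bondMeasure_infinite_ne_zero (c := Real.exp (-((p₁ : ℝ) - p₀))) ?_ ?_ hp₁
    · simpa using h01
    · refine expect_trapped_le_exp p₀.2.1 h01.le p₁.2.2 fun p hp S hS => ?_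
      exact hcon p (p₀.2.1.trans hp.1) (hp.2.trans hp₁c) hp.1 S hS

end Infinite

end Percolation

/-! ### Conclusion: subexponential growth. -/

theorem lemma2p2 {V : Type*} (G : SimpleGraph V) [G.LocallyFinite]
    (hG : Percolation.IsVertexTransitive G) (o : V) :
    ∃ f : ℕ → ℝ, f =o[atTop] (fun r : ℕ => (r : ℝ)) ∧
      ∀ r : ℕ, Percolation.expectedChemBall G (Percolation.criticalProb G o) o r =
        ENNReal.ofReal (Real.exp (f r)) := by
  classical
  set pc := Percolation.criticalProb G o
  let N : ℕ → ℝ := fun r => Percolation.expect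
    (Percolation.edgesInside G (Percolation.graphBall G o r)) pc
    fun T => ((Percolation.edgeBall T o r).card : ℝ)
  have hN : ∀ r, 1 ≤ N r := by
    intro r
    rw [← Percolation.expect_const (Percolation.edgesInside G (Percolation.graphBall G o r)) pc 1]
    refine Percolation.expect_mono pc.2 fun T _ => ?_
    exact_mod_cast Finset.card_pos.2 ⟨o, Percolation.mem_edgeBall.2 ⟨.nil, by simp⟩⟩
  refine ⟨fun r => Real.log (N r), ?_, fun r => ?_⟩
  · refine isLittleO_iff.2 fun c hc => ?_
    -- Half of `c` pays for the exponential rate; the other half absorbs `log C` once `r` is large.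
    obtain ⟨C, hC⟩ := Percolation.expect_criticalProb_le_exp hG o (half_pos hc)
    have hC0 : 0 < C := by
      have := (hN 0).trans (hC 0)
      simp only [Nat.cast_zero, mul_zero, Real.exp_zero, mul_one] at this
      linarith
    filter_upwards [eventually_ge_atTop ⌈Real.log C / (c / 2)⌉₊] with r hr
    have hr' : Real.log C / (c / 2) ≤ r := Nat.ceil_le.1 hr
    rw [div_le_iff₀ (half_pos hc)] at hr'
    rw [Real.norm_of_nonneg (Real.log_nonneg (hN r)), Real.norm_of_nonneg (Nat.cast_nonneg r)]
    have h := Real.log_le_log (zero_lt_one.trans_le (hN r)) (hC r)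
    rw [Real.log_mul hC0.ne' (Real.exp_pos _).ne', Real.log_exp] at h
    linarith
  · rw [Percolation.expectedChemBall_eq, Real.exp_log (zero_lt_one.trans_le (hN r))]
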